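/- **Setting.** All topologies are D-topologies of diffeologies, and $\mathbb{D}=\{z\in\mathbb{C}:|z|<1\}$. A *2-orbifold* is a Hausdorff, second countable diffeological space $B$ that is locally diffeomorphic to quotients $\mathbb{D}/\Gamma$, where $\Gamma$ is a finite group of rotations. A point $x\in B$ has *order* $m$ if there is an orbifold chart $\phi:\mathbb{D}/\Gamma\to D\subset B$ onto an open set, centered at $x$ (i.e. $\phi([0])=x$), with $|\Gamma|=m$; it is *singular* if $m\ge 2$ and *regular* otherwise. $B$ is *oriented* if the smooth surface of its regular points is oriented. An *$\mathbb{S}^1$-orbibundle* over $B$ is a smooth map $\zeta:M\to B$, where $M$ is a diffeological space with a smooth action of $\mathbb{S}^1$, such that every $p\in B$ has a chart $\phi:\mathbb{D}/\Gamma\to D$ centered at $p$, an action of $\Gamma$ on $\mathbb{D}\times\mathbb{S}^1$ of the form $h(x,s)=(hx,a(h,x)s)$ with $a:\Gamma\times\mathbb{D}\to\mathbb{S}^1$ smooth, and an $\mathbb{S}^1$-equivariant diffeomorphism $\Phi:(\mathbb{D}\times\mathbb{S}^1)/\Gamma\to\zeta^{-1}(D)$ with $\zeta(\Phi([x,s]))=\phi([x])$.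 **Euler number.** Let $B$ be a compact, connected, oriented 2-orbifold with singular points $x_1,\dots,x_n$, and let $\zeta:M\to B$ be an $\mathbb{S}^1$-orbibundle. Choose a regular point $x_0$ and small disjoint closed discs $D_i$ centered at $x_i$ ($0\le i\le n$), namely $D_i=\phi_i(\{|z|\le r_i\}/\Gamma_i)$, where $0<r_i<1$ and $\phi_i$ is an orientation preserving chart centered at $x_i$ over which $\zeta$ has the above form. Let $B'$ be the complement of the interiors $\phi_i(\{|z|<r_i\}/\Gamma_i)$ and choose a continuous section $\sigma:B'\to M$ of $\zeta$. Orient $\partial D_i$ as the boundary of $D_i$. In $H_1(\zeta^{-1}(D_i);\mathbb{Q})$ one has $\sigma|_{\partial D_i}=q_i\,s$ with $q_i\in\mathbb{Q}$, where $s$ is a fiber of $\zeta$ over a regular point of $D_i$, traversed once in the direction of the $\mathbb{S}^1$-orbits. The *Euler number* of $\zeta$ is $e(M)=\sum_{i=0}^n q_i$; that is, $\sigma|_{\partial B'}=-\sum_i\sigma|_{\partial D_i}=-e(M)\,s$. **Theorem.** Let $B$ be a compact, connected, oriented 2-orbifold with singular points $x_1,\dots,x_n$ of orders $m_1,\dots,m_n$.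 The Euler number $e(M)$ (computed from any choices as above) of any $\mathbb{S}^1$-orbibundle $\zeta:M\to B$ satisfies $$e(M)\in\mathbb{Z}+\tfrac1{m_1}\mathbb{Z}+\cdots+\tfrac1{m_n}\mathbb{Z}.$$ -/

import Mathlib

open Diffeology Topology Filter
open scoped Complex.UnitDisc

noncomputable section

/-! ### Initial and final diffeologies -/

/-- The initial (pullback) diffeology of a map `f : X → Y`: the largest diffeology on `X` for which
`f` is smooth. -/
@[reducible]
def DiffeologicalSpace.initial {X Y : Type*} [DiffeologicalSpace Y] (f : X → Y) :
    DiffeologicalSpace X where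
  plots _ := {p | IsPlot (f ∘ p)}
  constant_plots x := isPlot_const (x := f x)
  plot_reparam {_ _ p g} hp hf := isPlot_reparam (p := f ∘ p) (f := g) hp hf
  locality {n p} h := DiffeologicalSpace.locality (p := f ∘ p) (fun x => by
    obtain ⟨u, hu, hx, h'⟩ := h x
    exact ⟨u, hu, hx, fun hf hc => h' hf hc⟩)

/-- The final (pushforward) diffeology of a map `f : X → Y`: the smallest diffeology on `Y` for
which `f` is smooth. -/
@[reducible]
def DiffeologicalSpace.final {X Y : Type*} [DiffeologicalSpace X] (f : X → Y) :
    DiffeologicalSpace Y :=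
  DiffeologicalSpace.generateFrom
    {q | ∃ p : EuclideanSpace ℝ (Fin q.1) → X, IsPlot p ∧ q.2 = f ∘ p}

/-- The subspace diffeology. -/
instance Subtype.instDiffeologicalSpace {X : Type*} [DiffeologicalSpace X] (P : X → Prop) :
    DiffeologicalSpace {x // P x} :=
  DiffeologicalSpace.initial Subtype.val

/-- The product diffeology. -/
instance Prod.instDiffeologicalSpace {X Y : Type*} [DiffeologicalSpace X] [DiffeologicalSpace Y] :
    DiffeologicalSpace (X × Y) :=
  DiffeologicalSpace.initial Prod.fst ⊓ DiffeologicalSpace.initial Prod.snd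

/-- The quotient diffeology. -/
instance Quotient.instDiffeologicalSpace {X : Type*} [DiffeologicalSpace X] (s : Setoid X) :
    DiffeologicalSpace (Quotient s) :=
  DiffeologicalSpace.final (Quotient.mk s)

instance Complex.instDiffeologicalSpace : DiffeologicalSpace ℂ := NormedSpace.toDiffeology ℂ

instance Complex.UnitDisc.instDiffeologicalSpace : DiffeologicalSpace 𝔻 :=
  DiffeologicalSpace.initial ((↑) : 𝔻 → ℂ)

instance Circle.instDiffeologicalSpace : DiffeologicalSpace Circle :=
  DiffeologicalSpace.initial ((↑) : Circle → ℂ)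

/-! ### Two-dimensional orbifolds -/

/-- An orbifold chart of a (locally orientable, two-dimensional) orbifold: a diffeomorphism
`φ : 𝔻 / Γ → D`, where `𝔻` is the open unit disc of `ℂ = ℝ²`, `Γ` is a finite subgroup of
`SO(2) = 𝕊¹` acting by rotations, and `D` is an open subset of `B`. -/
structure OrbifoldChart (B : Type*) [TopologicalSpace B] [DiffeologicalSpace B] where
  Γ : Subgroup Circle
  finite_Γ : Finite Γ
  domain : Set B
  isOpen_domain : IsOpen domain
  φ : Quotient (MulAction.orbitRel Γ 𝔻) ≃ domain
  smooth_φ : DSmooth φ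
  smooth_φ_symm : DSmooth φ.symm

namespace OrbifoldChart

variable {B : Type*} [TopologicalSpace B] [DiffeologicalSpace B]

/-- The composition `𝔻 → 𝔻 / Γ → D ⊆ B` of the projection and the chart. -/
def lift (c : OrbifoldChart B) (z : 𝔻) : B := c.φ (Quotient.mk _ z)

/-- The point at which the chart is centered. -/
def center (c : OrbifoldChart B) : B := c.lift 0

/-- The closed disc of radius `r` of the chart, centered at `c.center`. -/
def closedDisc (c : OrbifoldChart B) (r : ℝ) : Set B := c.lift '' {z | ‖(z : ℂ)‖ ≤ r}

/-- The open disc of radius `r` of the chart, centered at `c.center`. -/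
def openDisc (c : OrbifoldChart B) (r : ℝ) : Set B := c.lift '' {z | ‖(z : ℂ)‖ < r}

end OrbifoldChart

/-- A (locally orientable) 2-orbifold: a Hausdorff, second countable diffeological space that is
locally diffeomorphic to quotients `𝔻 / Γ` with `Γ ⊆ SO(2)` finite. The topology of `B` is the
D-topology. -/
class IsTwoOrbifold (B : Type*) [TopologicalSpace B] [DiffeologicalSpace B] : Prop where
  dTopology_compatible : IsDTopologyCompatible B
  t2 : T2Space B
  secondCountable : SecondCountableTopology B
  exists_chart : ∀ x : B, ∃ c : OrbifoldChart B, x ∈ c.domain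

section

variable {B : Type*} [TopologicalSpace B] [DiffeologicalSpace B]

/-- `x` is a point of order `m`: there is an orbifold chart `𝔻 / Γ → D` centered at `x` such that
`Γ` has order `m`. -/
def HasOrder (x : B) (m : ℕ) : Prop :=
  ∃ c : OrbifoldChart B, c.center = x ∧ Nat.card c.Γ = m

/-- `x` is a singular point: there is a chart centered at `x` with nontrivial group. -/
def IsSingularPoint (x : B) : Prop :=
  ∃ c : OrbifoldChart B, c.center = x ∧ c.Γ ≠ ⊥

/-- A point is regular if it is not singular. -/
def IsRegularPoint (x : B) : Prop := ¬ IsSingularPoint x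

/-- Two charts induce the same orientation on the regular part of the intersection of their
domains: at regular points, the local diffeomorphisms `h` between discs that intertwine the two
charts have positive Jacobian determinant. -/
def OrientationCompatible (c c' : OrbifoldChart B) : Prop :=
  ∀ z w : 𝔻, c.lift z = c'.lift w → IsRegularPoint (c.lift z) →
    ∃ h : ℂ → ℂ, ContDiffAt ℝ (⊤ : ℕ∞) h z ∧ h z = w ∧ 0 < (fderiv ℝ h z).det ∧
      ∀ᶠ u : 𝔻 in 𝓝 z, ∃ v : 𝔻, (v : ℂ) = h u ∧ c'.lift v = c.lift u

end

/-- An orientation of a 2-orbifold `B`, i.e. of the smooth surface of its regular points, given by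
an oriented atlas of that surface: a family of charts `𝔻 → B` with trivial group that covers the
regular points and has orientation preserving transition maps. -/
structure OrbifoldOrientation (B : Type*) [TopologicalSpace B] [DiffeologicalSpace B] where
  atlas : Set (OrbifoldChart B)
  trivial_group : ∀ c ∈ atlas, c.Γ = ⊥
  covers : ∀ x : B, IsRegularPoint x → ∃ c ∈ atlas, x ∈ c.domain
  compatible : ∀ c ∈ atlas, ∀ c' ∈ atlas, OrientationCompatible c c'

/-- An orbifold chart `𝔻 / Γ → D` is positive if, away from singular points, it preserves the
orientations (`𝔻 ⊆ ℂ` having its standard orientation). -/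
def OrbifoldOrientation.IsPositive {B : Type*} [TopologicalSpace B] [DiffeologicalSpace B]
    (o : OrbifoldOrientation B) (c : OrbifoldChart B) : Prop :=
  ∀ c' ∈ o.atlas, OrientationCompatible c c'

/-! ### Circle orbibundles -/

/-- The data of a smooth map `a : Γ × 𝔻 → 𝕊¹` for which `h (x, s) = (h x, a(h, x) s)` is an action
of `Γ` on `𝔻 × 𝕊¹`. As `Γ` is finite, smoothness means smoothness in the second variable. -/
structure CircleCocycle (Γ : Subgroup Circle) where
  a : Γ → 𝔻 → Circle
  smooth : ∀ h, DSmooth (a h)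
  a_one : ∀ x, a 1 x = 1
  a_mul : ∀ g h x, a (g * h) x = a g (h • x) * a h x

/-- The orbit relation of the action `h (x, s) = (h x, a(h, x) s)` of `Γ` on `𝔻 × 𝕊¹`. -/
def CircleCocycle.orbitRel {Γ : Subgroup Circle} (α : CircleCocycle Γ) : Setoid (𝔻 × Circle) where
  r p q := ∃ h : Γ, (h • p.1, α.a h p.1 * p.2) = q
  iseqv :=
    { refl := fun p => ⟨1, by simp [α.a_one]⟩
      symm := by
        rintro p _ ⟨h, rfl⟩
        refine ⟨h⁻¹, Prod.ext (by simp) ?_⟩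
        have := α.a_mul h⁻¹ h p.1
        rw [inv_mul_cancel, α.a_one] at this
        simp [← mul_assoc, ← this]
      trans := by
        rintro p _ _ ⟨h, rfl⟩ ⟨g, rfl⟩
        exact ⟨g * h, Prod.ext (by simp [mul_smul]) (by simp [α.a_mul, mul_assoc])⟩ }

section

variable {B M : Type*} [TopologicalSpace B] [DiffeologicalSpace B] [DiffeologicalSpace M]
  [MulAction Circle M]

/-- A local model of an `𝕊¹`-orbibundle `ζ : M → B`: an orbifold chart `φ : 𝔻 / Γ → D`, an action
`h (x, s) = (h x, a(h, x) s)` of `Γ` on `𝔻 × 𝕊¹`, and an `𝕊¹`-equivariant diffeomorphism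
`Φ : (𝔻 × 𝕊¹) / Γ → ζ⁻¹(D)` over `φ`. -/
structure CircleOrbibundleChart (ζ : M → B) extends OrbifoldChart B where
  cocycle : CircleCocycle Γ
  Φ : Quotient cocycle.orbitRel ≃ (ζ ⁻¹' domain : Set M)
  smooth_Φ : DSmooth Φ
  smooth_Φ_symm : DSmooth Φ.symm
  comm : ∀ (x : 𝔻) (s : Circle), ζ (Φ (Quotient.mk _ (x, s))) = φ (Quotient.mk _ x)
  equivariant : ∀ (x : 𝔻) (s t : Circle),
    (Φ (Quotient.mk _ (x, s * t)) : M) = t • (Φ (Quotient.mk _ (x, s)) : M)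

/-- `ζ : M → B` is an `𝕊¹`-orbibundle. -/
structure IsCircleOrbibundle (ζ : M → B) : Prop where
  smooth : DSmooth ζ
  smooth_smul : DSmooth (fun p : Circle × M => p.1 • p.2)
  exists_chart : ∀ p : B, ∃ c : CircleOrbibundleChart ζ, c.center = p

end

/-! ### The Euler number -/

/-- The first singular homology `H₁(X; ℚ)` of a topological space. -/
abbrev rationalH1.{v} (X : Type v) [TopologicalSpace X] : ModuleCat.{v} ℚ :=
  ((AlgebraicTopology.singularHomologyFunctor (ModuleCat.{v} ℚ) 1).obj
    (ModuleCat.of ℚ (ULift.{v} ℚ))).obj (TopCat.of X)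

/-- The map induced on `H₁(·; ℚ)` by a loop `γ : 𝕊¹ → X`. The class `[γ]` in `H₁(X; ℚ)` is the
image of the fundamental class of `𝕊¹`; as the latter generates `H₁(𝕊¹; ℚ)`, an identity
`[γ] = q [γ']` between classes of loops is the identity `loopClass γ = q • loopClass γ'`. -/
def loopClass.{v} {X : Type v} [TopologicalSpace X] (γ : C(Circle, X)) :
    rationalH1 (ULift.{v} Circle) ⟶ rationalH1 X :=
  ((AlgebraicTopology.singularHomologyFunctor (ModuleCat.{v} ℚ) 1).obj
    (ModuleCat.of ℚ (ULift.{v} ℚ))).map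
      (TopCat.ofHom (γ.comp ⟨ULift.down, continuous_uliftDown⟩))

/-- The choices from which the Euler number of an `𝕊¹`-orbibundle `ζ : M → B` over an oriented
2-orbifold with finitely many singular points is computed. -/
structure EulerData.{u, v} {B : Type u} {M : Type v} [TopologicalSpace B] [DiffeologicalSpace B]
    [TopologicalSpace M] [DiffeologicalSpace M] [MulAction Circle M]
    (o : OrbifoldOrientation B) (ζ : M → B) where
  /-- the number of singular points -/
  N : ℕ
  /-- a regular point `pt 0`, followed by the singular points -/
  pt : Fin (N + 1) → B
  pt_injective : Function.Injective pt
  regular_zero : IsRegularPoint (pt 0)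
  range_succ : Set.range (fun k : Fin N => pt k.succ) = {x | IsSingularPoint x}
  /-- the discs `D i` centered at the points `pt i`: the disc of radius `radius i` in a positively
  oriented chart -/
  chart : Fin (N + 1) → CircleOrbibundleChart ζ
  center_chart : ∀ i, (chart i).center = pt i
  positive_chart : ∀ i, o.IsPositive (chart i).toOrbifoldChart
  radius : Fin (N + 1) → ℝ
  radius_pos : ∀ i, 0 < radius i
  radius_lt_one : ∀ i, radius i < 1
  disjoint : ∀ i j, i ≠ j →
    Disjoint ((chart i).closedDisc (radius i)) ((chart j).closedDisc (radius j))
  /-- a section `σ` over the complement `B'` of the open discs -/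
  σ : B → M
  continuousOn_σ : ContinuousOn σ (⋃ i, (chart i).openDisc (radius i))ᶜ
  section_σ : ∀ b ∉ ⋃ i, (chart i).openDisc (radius i), ζ (σ b) = b
  /-- the loop `σ|∂D i`, with `∂D i` traversed once, as the positively oriented boundary of `D i`.
  The boundary of `D i` is the quotient by `Γ` of a circle, and `z ↦ z ^ |Γ|` identifies the
  quotient `𝕊¹ / Γ` with `𝕊¹`. -/
  boundaryLoop : ∀ i, C(Circle, (ζ ⁻¹' (chart i).closedDisc (radius i) : Set M))
  boundaryLoop_pow : ∀ (i : Fin (N + 1)) (z : Circle) (w : 𝔻), (w : ℂ) = radius i * (z : ℂ) →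
    (boundaryLoop i (z ^ Nat.card (chart i).Γ) : M) = σ ((chart i).lift w)
  /-- a fiber `s` of `ζ` over a regular point of `D i`, traversed once along the `𝕊¹`-orbit -/
  fiberLoop : ∀ i, C(Circle, (ζ ⁻¹' (chart i).closedDisc (radius i) : Set M))
  fiberLoop_smul : ∀ i z, (fiberLoop i z : M) = z • (fiberLoop i 1 : M)
  regular_fiberLoop : ∀ i, IsRegularPoint (ζ (fiberLoop i 1))
  /-- the rational number `q i` with `σ|∂D i = q i • s` in `H₁(ζ⁻¹(D i); ℚ)` -/
  q : Fin (N + 1) → ℚ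
  loopClass_eq : ∀ i, loopClass (boundaryLoop i) = q i • loopClass (fiberLoop i)

/-- `e` is the Euler number of the `𝕊¹`-orbibundle `ζ : M → B`: it is the sum of the numbers `q i`
with `σ|∂D i = q i • s`, i.e. `σ|∂B' = - ∑ i, σ|∂D i = - e • s`. -/
def IsEulerNumber {B M : Type*} [TopologicalSpace B] [DiffeologicalSpace B]
    [TopologicalSpace M] [DiffeologicalSpace M] [MulAction Circle M]
    (o : OrbifoldOrientation B) (ζ : M → B) (e : ℚ) : Prop :=
  ∃ d : EulerData o ζ, e = ∑ i, d.q i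

end

/-!
The Euler number is a sum of local contributions `q i`, one for each disc `D i`, and the claim is
local: `q i` is an integer multiple of `1 / |Γ i|`, where `Γ i` is the group of the chart around
`D i` (`EulerData.exists_int_q_eq_div`).

In the local model `(𝔻 × 𝕊¹) / Γ`, whose action is given by a cocycle `a`, the function
`u(x) = ∏ g, a(g, x)` satisfies `u(h x) a(h, x) ^ |Γ| = u(x)`. So `[x, s] ↦ u(x) s ^ |Γ|` is a
well-defined map to the circle, and it has degree `|Γ|` along each `𝕊¹`-orbit. A map `P : X → 𝕊¹`
induces a functional on `H₁(X; ℚ)`, given by the cocycle that measures the change of an angle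
function of `P` along a singular `1`-simplex; on the class of a loop it is `2π` times the degree of
`P` along the loop, an integer multiple of `2π`. Applied to `σ|∂D i = q i • s`, this gives
`q i |Γ i| ∈ ℤ` (`exists_int_of_loopClass_eq_smul`).

It remains to see that `|Γ i|` is the order `m k` of the center of `D i`, although the order may
be witnessed by another chart (`OrbifoldChart.card_eq_of_center_eq`). Plots of a quotient `𝔻 / Γ`
locally lift to `𝔻`, so the changes of charts lift to continuous maps `F` and `G` of discs near the
origin. The composition `G ∘ F` moves each point within its orbit, hence is a rotation on a small
circle. Therefore `F` maps an orbit of one group injectively into an orbit of the other group.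
-/

noncomputable section

/-! ### Angle functions on contractible spaces -/

section AngleChange

variable {X Y : Type*} [TopologicalSpace X] [TopologicalSpace Y]

/-- Every map from a contractible space to the circle has an angle function: lift a contraction of
the space along the covering `exp : ℝ → 𝕊¹`. -/
theorem Circle.exists_angle [ContractibleSpace X] (f : C(X, Circle)) :
    ∃ g : C(X, ℝ), ∀ x, Circle.exp (g x) = f x := by
  obtain ⟨x₀, ⟨H⟩⟩ := id_nullhomotopic X
  obtain ⟨t₀, ht₀⟩ : ∃ t₀, Circle.exp t₀ = f x₀ := ⟨_, Circle.exp_arg (f x₀)⟩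
  have h0 : ∀ a, (f.comp H.symm.toContinuousMap) (0, a) =
      Circle.exp ((ContinuousMap.const X t₀) a) := by
    intro a
    simp [ht₀]
  refine ⟨(Circle.isCoveringMap_exp.liftHomotopy _ _ h0).comp
    ((ContinuousMap.const X 1).prodMk (ContinuousMap.id X)), fun x => ?_⟩
  have h1 := congrFun (Circle.isCoveringMap_exp.liftHomotopy_lifts _ _ h0) (1, x)
  have h2 : H.symm (1, x) = x := by simp
  have h3 := congrArg f h2
  exact h1.trans h3

/-- The change `g y - g x` of an angle function `g` of `f : X → 𝕊¹`, i.e. of a continuous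
`g : X → ℝ` with `f = exp (i g)`, between two points of a contractible space `X`. -/
def Circle.angleChange [ContractibleSpace X] (f : C(X, Circle)) (x y : X) : ℝ :=
  (Circle.exists_angle f).choose y - (Circle.exists_angle f).choose x

theorem Circle.angleChange_eq [ContractibleSpace X] {f : C(X, Circle)} {g : X → ℝ}
    (hg : Continuous g) (h : ∀ x, Circle.exp (g x) = f x) (x y : X) :
    Circle.angleChange f x y = g y - g x := by
  have hs := (Circle.exists_angle f).choose_spec
  unfold Circle.angleChange
  set k := (Circle.exists_angle f).choose
  -- shifting an angle function so that it agrees with `g` at `x` gives two lifts of `f`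
  have key : (fun z => k z - k x + g x) = g := by
    refine Circle.isCoveringMap_exp.eq_of_comp_eq (by fun_prop) hg ?_ x (by simp)
    ext1 z
    simp [sub_eq_add_neg, Circle.exp_add, Circle.exp_neg, hs, h]
  have := congrFun key y
  linarith

theorem Circle.angleChange_comp [ContractibleSpace X] [ContractibleSpace Y] (f : C(Y, Circle))
    (u : C(X, Y)) (x y : X) :
    Circle.angleChange (f.comp u) x y = Circle.angleChange f (u x) (u y) := by
  obtain ⟨g, hg⟩ := Circle.exists_angle f
  rw [Circle.angleChange_eq (g := g ∘ u) (by fun_prop) (fun z => by simp [hg]),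
    Circle.angleChange_eq g.continuous hg]
  rfl

theorem Circle.angleChange_add [ContractibleSpace X] (f : C(X, Circle)) (x y z : X) :
    Circle.angleChange f x y + Circle.angleChange f y z = Circle.angleChange f x z := by
  simp [Circle.angleChange]

/-- An angle function changes by a full number of turns between points where `f` agrees. -/
theorem Circle.exists_angleChange_eq [ContractibleSpace X] {f : C(X, Circle)} {x y : X}
    (h : f x = f y) : ∃ k : ℤ, Circle.angleChange f x y = k * (2 * Real.pi) := by
  obtain ⟨g, hg⟩ := Circle.exists_angle f
  rw [Circle.angleChange_eq g.continuous hg]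
  obtain ⟨k, hk⟩ := Circle.exp_eq_exp.1 ((hg y).trans (h.symm.trans (hg x).symm))
  exact ⟨k, by rw [hk]; ring⟩

end AngleChange

/-! ### The winding functional on first homology -/

section Winding

open CategoryTheory Simplicial Limits AlgebraicTopology

instance stdSimplex.contractibleSpace {ι : Type*} [Fintype ι] [Nonempty ι] :
    ContractibleSpace (stdSimplex ℝ ι) :=
  (convex_stdSimplex ℝ ι).contractibleSpace (Set.nonempty_coe_sort.1 inferInstance)

universe v

variable {X : Type v} [TopologicalSpace X]

/-- The complex of singular chains of `X` with coefficients in `ℚ`. -/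
abbrev rationalChains (X : Type v) [TopologicalSpace X] : ChainComplex (ModuleCat.{v} ℚ) ℕ :=
  (TopCat.toSSet.obj (TopCat.of X)).chainComplex (ModuleCat.of ℚ (ULift.{v} ℚ))

/-- The continuous map underlying a singular simplex. -/
def simplexMap {n : ℕ} (σ : (TopCat.toSSet.obj (TopCat.of X)) _⦋n⦌) :
    C(stdSimplex ℝ (Fin (n + 1)), X) :=
  TopCat.toSSetObjEquiv (TopCat.of X) (Opposite.op ⦋n⦌) σ

theorem simplexMap_δ {n : ℕ} (σ : (TopCat.toSSet.obj (TopCat.of X)) _⦋n + 1⦌) (i : Fin (n + 2)) :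
    simplexMap ((TopCat.toSSet.obj (TopCat.of X)).δ i σ) =
      (simplexMap σ).comp ⟨_, stdSimplex.continuous_map i.succAbove⟩ := rfl

/-- The singular `1`-cochain of `X` with values in `ℝ` which assigns to a singular `1`-simplex `σ`
the change of angle of `P ∘ σ`. -/
def windingCochain (P : C(X, Circle)) :
    (rationalChains X).X 1 ⟶ ModuleCat.of ℚ (ULift.{v} ℝ) :=
  Cofan.IsColimit.desc (SSet.isColimitChainComplexXCofan _ _ 1) fun σ => ModuleCat.ofHom
    ((LinearMap.toSpanSingleton ℚ (ULift.{v} ℝ) ⟨Circle.angleChange (P.comp (simplexMap σ))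
      (stdSimplex.vertex 0) (stdSimplex.vertex 1)⟩).comp
        (ULift.moduleEquiv : ULift.{v} ℚ ≃ₗ[ℚ] ℚ).toLinearMap)

theorem ι_windingCochain (P : C(X, Circle)) (σ : (TopCat.toSSet.obj (TopCat.of X)) _⦋1⦌) :
    SSet.ιChainComplex (TopCat.toSSet.obj (TopCat.of X)) (R := ModuleCat.of ℚ (ULift.{v} ℚ)) σ ≫
        windingCochain P =
      ModuleCat.ofHom ((LinearMap.toSpanSingleton ℚ (ULift.{v} ℝ)
        ⟨Circle.angleChange (P.comp (simplexMap σ))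
          (stdSimplex.vertex 0) (stdSimplex.vertex 1)⟩).comp
            (ULift.moduleEquiv : ULift.{v} ℚ ≃ₗ[ℚ] ℚ).toLinearMap) :=
  Cofan.IsColimit.fac (SSet.isColimitChainComplexXCofan _ _ 1) _ σ

/-- The winding cochain is a cocycle: along the boundary of a `2`-simplex the changes of an angle
function, which exists on the whole simplex, cancel. -/
theorem d_windingCochain (P : C(X, Circle)) :
    (rationalChains X).d 2 1 ≫ windingCochain P = 0 := by
  refine SSet.chainComplex_hom_ext fun σ => ?_
  rw [SSet.ιChainComplex_d_assoc]
  simp only [Preadditive.sum_comp, Linear.smul_comp, ι_windingCochain]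
  simp only [simplexMap_δ, ← ContinuousMap.comp_assoc]
  simp only [Circle.angleChange_comp _ ⟨_, _⟩, ContinuousMap.coe_mk, stdSimplex.map_vertex]
  ext x
  have h2 : (2 : Fin 3).succAbove (1 : Fin 2) = 1 := rfl
  have h012 := Circle.angleChange_add (P.comp (simplexMap σ)) (stdSimplex.vertex 0)
    (stdSimplex.vertex 1) (stdSimplex.vertex 2)
  simp [Fin.sum_univ_three, h2, ← h012, Rat.smul_def]
  ring

/-- The functional on `H₁(X; ℚ)` induced by the winding cocycle of `P : X → 𝕊¹`. It takes values in
`ℝ` and is not divided by `2π`: a loop along which `P` has degree `k` is sent to `2πk`. -/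
def winding (P : C(X, Circle)) : (rationalChains X).homology 1 ⟶ ModuleCat.of ℚ (ULift.{v} ℝ) :=
  (rationalChains X).homologyι 1 ≫
    (rationalChains X).descOpcycles (windingCochain P) 2 (by simp) (d_windingCochain P)

/-- The path which runs once around the circle, parametrized by the `1`-simplex. -/
def circlePath : C(stdSimplex ℝ (Fin 2), Circle) where
  toFun s := Circle.exp (2 * Real.pi * s.1 1)
  continuous_toFun := Circle.exp.continuous.comp
    (continuous_const.mul ((continuous_apply 1).comp continuous_subtype_val))

theorem circlePath_vertex_zero : circlePath (stdSimplex.vertex 0) = 1 := by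
  simp [circlePath]

theorem circlePath_vertex_one : circlePath (stdSimplex.vertex 1) = 1 := by
  simp [circlePath]

/-- The singular `1`-simplex of `𝕊¹` that runs once around the circle. -/
def circleSimplex : (TopCat.toSSet.obj (TopCat.of (ULift.{v} Circle))) _⦋1⦌ :=
  (TopCat.toSSetObjEquiv (TopCat.of (ULift.{v} Circle)) (Opposite.op ⦋1⦌)).symm
    ((⟨ULift.up, continuous_uliftUp⟩ : C(Circle, ULift.{v} Circle)).comp circlePath)

theorem circleSimplex_d :
    SSet.ιChainComplex (TopCat.toSSet.obj (TopCat.of (ULift.{v} Circle)))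
      (R := ModuleCat.of ℚ (ULift.{v} ℚ)) circleSimplex ≫
        (rationalChains (ULift.{v} Circle)).d 1 0 = 0 := by
  rw [SSet.ιChainComplex_d]
  have : (TopCat.toSSet.obj (TopCat.of (ULift.{v} Circle))).δ 0 circleSimplex =
      (TopCat.toSSet.obj (TopCat.of (ULift.{v} Circle))).δ 1 circleSimplex := by
    refine (TopCat.toSSetObjEquiv (TopCat.of (ULift.{v} Circle)) (Opposite.op ⦋0⦌)).injective ?_
    change simplexMap _ = simplexMap _
    rw [simplexMap_δ, simplexMap_δ]
    ext1 s
    obtain rfl : s = stdSimplex.vertex 0 := Subsingleton.elim (α := stdSimplex ℝ (Fin 1)) _ _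
    change ULift.up (circlePath (stdSimplex.map _ (stdSimplex.vertex 0))) =
      ULift.up (circlePath (stdSimplex.map _ (stdSimplex.vertex 0)))
    rw [stdSimplex.map_vertex, stdSimplex.map_vertex]
    exact congrArg ULift.up (circlePath_vertex_one.trans circlePath_vertex_zero.symm)
  simp [Fin.sum_univ_two, this]

/-- The fundamental class of the circle, as a map from the coefficients to the first homology. -/
def circleClass :
    ModuleCat.of ℚ (ULift.{v} ℚ) ⟶ (rationalChains (ULift.{v} Circle)).homology 1 :=
  (rationalChains (ULift.{v} Circle)).liftCycles _ 0 (by simp) circleSimplex_d ≫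
    (rationalChains (ULift.{v} Circle)).homologyπ 1

/-- The map on singular chains induced by a loop. -/
abbrev loopChainMap (γ : C(Circle, X)) : rationalChains (ULift.{v} Circle) ⟶ rationalChains X :=
  SSet.chainComplexMap
    (TopCat.toSSet.map (TopCat.ofHom (γ.comp ⟨ULift.down, continuous_uliftDown⟩)))
      (ModuleCat.of ℚ (ULift.{v} ℚ))

/-- The winding functional of `P`, evaluated on the class of a loop `γ`, is the change of angle of
`P ∘ γ` in one turn. -/
theorem circleClass_homologyMap_winding (γ : C(Circle, X)) (P : C(X, Circle)) :
    circleClass ≫ HomologicalComplex.homologyMap (loopChainMap γ) 1 ≫ winding P =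
      ModuleCat.ofHom ((LinearMap.toSpanSingleton ℚ (ULift.{v} ℝ)
        ⟨Circle.angleChange ((P.comp γ).comp circlePath)
          (stdSimplex.vertex 0) (stdSimplex.vertex 1)⟩).comp
            (ULift.moduleEquiv : ULift.{v} ℚ ≃ₗ[ℚ] ℚ).toLinearMap) := by
  rw [circleClass, winding]
  simp only [Category.assoc, HomologicalComplex.homologyπ_naturality_assoc,
    HomologicalComplex.homology_π_ι_assoc, HomologicalComplex.p_descOpcycles,
    HomologicalComplex.liftCycles_comp_cyclesMap_assoc, HomologicalComplex.liftCycles_i_assoc,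
    SSet.ι_chainComplexMap_f, ι_windingCochain]
  rfl

/-- If a map `P : X → 𝕊¹` has degree `m` along a loop `δ` and `[γ] = q • [δ]`, then `q * m` is the
degree of `P` along `γ`, hence an integer. -/
theorem exists_int_of_loopClass_eq_smul (P : C(X, Circle)) {γ δ : C(Circle, X)} {q : ℚ} {m : ℕ}
    (hδ : ∀ z, P (δ z) = z ^ m * P (δ 1)) (h : loopClass γ = q • loopClass δ) :
    ∃ k : ℤ, q * m = k := by
  -- by definition, `loopClass` is the map on homology induced by `loopChainMap`
  have h' : HomologicalComplex.homologyMap (loopChainMap γ) 1 =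
    q • HomologicalComplex.homologyMap (loopChainMap δ) 1 := h
  have key := circleClass_homologyMap_winding γ P
  rw [h', Linear.smul_comp, Linear.comp_smul, circleClass_homologyMap_winding δ P] at key
  have key' := congrArg
    (fun f : ModuleCat.of ℚ (ULift.{v} ℚ) ⟶ ModuleCat.of ℚ (ULift.{v} ℝ) =>
      (f.hom (ULift.up 1)).down) key
  simp at key'
  obtain ⟨k, hk⟩ := Circle.exists_angleChange_eq (f := (P.comp γ).comp circlePath)
    (x := stdSimplex.vertex 0) (y := stdSimplex.vertex 1)
    (by simp [circlePath_vertex_zero, circlePath_vertex_one])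
  obtain ⟨t, ht⟩ : ∃ t, Circle.exp t = P (δ 1) := ⟨_, Circle.exp_arg _⟩
  have hm : Circle.angleChange ((P.comp δ).comp circlePath)
      (stdSimplex.vertex 0) (stdSimplex.vertex 1) = m * (2 * Real.pi) := by
    rw [Circle.angleChange_eq (g := fun s => m * (2 * Real.pi * s.1 1) + t)]
    · simp
    · exact (continuous_const.mul (continuous_const.mul
        ((continuous_apply 1).comp continuous_subtype_val))).add continuous_const
    · intro s
      simpa [Circle.exp_add, ht, circlePath] using (hδ (circlePath s)).symm
  refine ⟨k, ?_⟩
  rw [← ContinuousMap.comp_assoc, ← ContinuousMap.comp_assoc, hk, hm, Rat.smul_def, ← mul_assoc]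
    at key'
  exact_mod_cast mul_right_cancel₀ Real.two_pi_pos.ne' key'

end Winding

/-! ### Local lifts of plots and continuity -/

section Plots

open OpenPartialHomeomorph (univBall)
open scoped ContDiff

variable {X Y Z : Type*}

/-- Germs at `x` can be tested after a smooth reparametrization of a small ball around `x` by the
whole space; this turns local statements into statements about plots. -/
theorem map_univBall_nhds {n : ℕ} (x : EuclideanSpace ℝ (Fin n)) (ε : ℝ) :
    map (univBall x ε) (𝓝 0) = 𝓝 x := by
  rw [OpenPartialHomeomorph.map_nhds_eq _ (by simp), OpenPartialHomeomorph.univBall_apply_zero]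

theorem univBall_mem_ball {n : ℕ} (x y : EuclideanSpace ℝ (Fin n)) {ε : ℝ} (hε : 0 < ε) :
    univBall x ε y ∈ Metric.ball x ε := by
  simpa [OpenPartialHomeomorph.univBall_target x hε] using
    (univBall x ε).map_source (x := y) (by simp)

/-- The diffeology on a quotient whose plots are the maps that locally lift to plots upstairs. As
plots are defined on whole Euclidean spaces, a lift over an open set `u` is encoded as lifts of all
smooth reparametrizations with values in `u`. -/
@[reducible]
def DiffeologicalSpace.locallyLiftable [DiffeologicalSpace X] (s : Setoid X) :
    DiffeologicalSpace (Quotient s) where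
  plots n := {p | ∀ x : EuclideanSpace ℝ (Fin n), ∃ u, IsOpen u ∧ x ∈ u ∧
    ∀ {m : ℕ} {f : EuclideanSpace ℝ (Fin m) → EuclideanSpace ℝ (Fin n)},
      (∀ y, f y ∈ u) → ContDiff ℝ ∞ f →
        ∃ l : EuclideanSpace ℝ (Fin m) → X, IsPlot l ∧ ∀ y, Quotient.mk s (l y) = p (f y)}
  constant_plots {n} x _ := by
    obtain ⟨x, rfl⟩ := Quotient.exists_rep x
    exact ⟨Set.univ, isOpen_univ, trivial, fun _ _ => ⟨fun _ => x, isPlot_const, fun _ => rfl⟩⟩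
  plot_reparam {n m p g} hp hg x := by
    obtain ⟨u, hu, hx, h⟩ := hp (g x)
    exact ⟨g ⁻¹' u, hu.preimage hg.continuous, hx, fun hf hfc => h hf (hg.comp hfc)⟩
  locality {n p} hp x := by
    obtain ⟨u, hu, hx, h⟩ := hp x
    obtain ⟨ε, hε, hball⟩ := Metric.isOpen_iff.1 hu x hx
    obtain ⟨v, hv, h0, hl⟩ := h (fun y => hball (univBall_mem_ball x y hε))
      OpenPartialHomeomorph.contDiff_univBall 0
    have htar := OpenPartialHomeomorph.univBall_target x hε
    refine ⟨(univBall x ε).target ∩ (univBall x ε).symm ⁻¹' v,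
      (univBall x ε).isOpen_inter_preimage_symm hv, ⟨?_, ?_⟩, fun {m f} hf hfc => ?_⟩
    · rw [htar]; exact Metric.mem_ball_self hε
    · simpa using h0
    · obtain ⟨l, hl, hlf⟩ := hl (f := (univBall x ε).symm ∘ f) (fun y => (hf y).2) (by
        rw [← contDiffOn_univ]
        exact OpenPartialHomeomorph.contDiffOn_univBall_symm.comp hfc.contDiffOn
          (fun y _ => htar ▸ (hf y).1))
      refine ⟨l, hl, fun y => (hlf y).trans ?_⟩
      exact congrArg p ((univBall x ε).right_inv (hf y).1)

/-- Plots of a quotient locally lift: the quotient diffeology is generated by liftable plots, and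
the locally liftable maps already form a diffeology. -/
theorem Diffeology.IsPlot.exists_quotient_lift [DiffeologicalSpace X] {s : Setoid X} {n : ℕ}
    {p : EuclideanSpace ℝ (Fin n) → Quotient s} (hp : IsPlot p) (x : EuclideanSpace ℝ (Fin n)) :
    ∃ ε > 0, ∃ l : EuclideanSpace ℝ (Fin n) → X, IsPlot l ∧
      ∀ y, Quotient.mk s (l y) = p (univBall x ε y) := by
  obtain ⟨u, hu, hx, h⟩ := hp (DiffeologicalSpace.locallyLiftable s) (by
    rintro ⟨n, q⟩ ⟨l, hl, hq⟩ y
    exact ⟨Set.univ, isOpen_univ, trivial,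
      fun {m f} _ hf => ⟨l ∘ f, isPlot_reparam hl hf, fun y => (congrFun hq (f y)).symm⟩⟩) x
  obtain ⟨ε, hε, hball⟩ := Metric.isOpen_iff.1 hu x hx
  exact ⟨ε, hε, h (fun y => hball (univBall_mem_ball x y hε))
    OpenPartialHomeomorph.contDiff_univBall⟩

/-- A plot of `Y` restricts, near a point of the preimage of an open set `D`, to a plot of `D`. -/
theorem Diffeology.IsPlot.exists_isPlot_subtype [TopologicalSpace Y] [DiffeologicalSpace Y]
    [IsDTopologyCompatible Y] {D : Set Y} (hD : IsOpen D) {n : ℕ}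
    {p : EuclideanSpace ℝ (Fin n) → Y} (hp : IsPlot p) {x : EuclideanSpace ℝ (Fin n)}
    (hx : p x ∈ D) :
    ∃ ε > 0, ∃ q : EuclideanSpace ℝ (Fin n) → D, IsPlot q ∧
      ∀ y, (q y : Y) = p (univBall x ε y) := by
  have hpD : IsOpen (p ⁻¹' D) := by
    rw [← IsDTopologyCompatible.dTop_eq Y] at hD
    exact isOpen_iff_preimages_plots.1 hD n p hp
  obtain ⟨ε, hε, hball⟩ := Metric.isOpen_iff.1 hpD x hx
  exact ⟨ε, hε, fun y => ⟨p (univBall x ε y), hball (univBall_mem_ball x y hε)⟩,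
    isPlot_reparam hp OpenPartialHomeomorph.contDiff_univBall, fun _ => rfl⟩

theorem Diffeology.IsPlot.continuous_circle {n : ℕ}
    {p : EuclideanSpace ℝ (Fin n) → Circle} (hp : IsPlot p) : Continuous p :=
  Topology.IsInducing.subtypeVal.continuous_iff.2 (ContDiff.continuous (𝕜 := ℝ) (n := ∞) hp)

theorem continuousAt_of_univBall [TopologicalSpace Z] {n : ℕ} {F : EuclideanSpace ℝ (Fin n) → Z}
    {x : EuclideanSpace ℝ (Fin n)} {ε : ℝ}
    {G : EuclideanSpace ℝ (Fin n) → Z} (hG : Continuous G) (h : ∀ y, F (univBall x ε y) = G y) :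
    ContinuousAt F x := by
  have h' : F ∘ univBall x ε = G := funext h
  have h0 := h 0
  rw [OpenPartialHomeomorph.univBall_apply_zero] at h0
  rw [ContinuousAt, ← map_univBall_nhds x ε, tendsto_map'_iff, h', h0]
  exact hG.continuousAt

/-- A function on a quotient is continuous along plots if it is so upstairs. -/
theorem continuous_quotient_comp_isPlot [DiffeologicalSpace X] [TopologicalSpace Z] {s : Setoid X}
    {F : Quotient s → Z}
    (hF : ∀ {n : ℕ} {l : EuclideanSpace ℝ (Fin n) → X}, IsPlot l →
      Continuous fun y => F (Quotient.mk s (l y)))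
    {n : ℕ} {p : EuclideanSpace ℝ (Fin n) → Quotient s} (hp : IsPlot p) :
    Continuous (F ∘ p) := by
  refine continuous_iff_continuousAt.2 fun x => ?_
  obtain ⟨ε, -, l, hl, h⟩ := hp.exists_quotient_lift x
  exact continuousAt_of_univBall (hF hl) fun y => congrArg F (h y).symm

/-- On an open subset of a space with the D-topology, a function which is continuous along the
plots of the subset is continuous. -/
theorem continuous_of_continuous_comp_isPlot [TopologicalSpace Y] [DiffeologicalSpace Y]
    [IsDTopologyCompatible Y] [TopologicalSpace Z] {D : Set Y} (hD : IsOpen D) {F : D → Z}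
    (hF : ∀ {n : ℕ} {q : EuclideanSpace ℝ (Fin n) → D}, IsPlot q → Continuous (F ∘ q)) :
    Continuous F := by
  refine continuous_def.2 fun V hV => ?_
  rw [hD.isOpenEmbedding_subtypeVal.isOpen_iff_image_isOpen, ← IsDTopologyCompatible.dTop_eq Y,
    isOpen_iff_preimages_plots]
  intro n p hp
  refine isOpen_iff_mem_nhds.2 fun x hx => ?_
  obtain ⟨d, hd, hdx⟩ := hx
  obtain ⟨ε, -, q, hq, hqp⟩ := hp.exists_isPlot_subtype hD (x := x) (hdx ▸ d.2)
  have hq0 : q 0 = d := Subtype.ext (by rw [hqp, OpenPartialHomeomorph.univBall_apply_zero, hdx])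
  rw [← map_univBall_nhds x ε, mem_map]
  filter_upwards [(hV.preimage (hF hq)).mem_nhds (x := 0) (by simpa [hq0] using hd)] with y hy
  exact ⟨q y, hy, hqp y⟩

end Plots

/-! ### The order of a point of a 2-orbifold -/

namespace OrbifoldChart

open OpenPartialHomeomorph (univBall)
open scoped ContDiff

variable {B : Type*} [TopologicalSpace B] [DiffeologicalSpace B]

theorem lift_eq_lift_iff (c : OrbifoldChart B) {z w : 𝔻} :
    c.lift z = c.lift w ↔ ∃ g : c.Γ, g • w = z := by
  unfold lift
  rw [Subtype.coe_inj, c.φ.apply_eq_iff_eq, Quotient.eq]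
  rfl

theorem closedDisc_subset_domain (c : OrbifoldChart B) (r : ℝ) : c.closedDisc r ⊆ c.domain := by
  rintro _ ⟨z, -, rfl⟩
  exact (c.φ _).2

theorem isPlot_lift (c : OrbifoldChart B) {n : ℕ} {p : EuclideanSpace ℝ (Fin n) → 𝔻}
    (hp : IsPlot p) : IsPlot (c.lift ∘ p) := by
  have h1 : IsPlot (Quotient.mk (MulAction.orbitRel c.Γ 𝔻) ∘ p) :=
    DiffeologicalSpace.isPlot_generatedFrom_of_mem ⟨p, hp, rfl⟩
  exact c.smooth_φ _ _ h1

/-- Near a point where it takes a value in the domain of a chart, a plot of `B` lifts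
continuously to the disc of this chart. -/
theorem exists_lift_isPlot [IsDTopologyCompatible B] (c : OrbifoldChart B) {n : ℕ}
    {p : EuclideanSpace ℝ (Fin n) → B} (hp : IsPlot p) {x : EuclideanSpace ℝ (Fin n)}
    (hx : p x ∈ c.domain) :
    ∃ u ∈ 𝓝 x, ∃ l : EuclideanSpace ℝ (Fin n) → 𝔻, ContinuousOn l u ∧
      ∀ y ∈ u, c.lift (l y) = p y := by
  obtain ⟨ε, -, q, hq, hqp⟩ := hp.exists_isPlot_subtype c.isOpen_domain hx
  obtain ⟨δ, -, l, hl, hlq⟩ := (c.smooth_φ_symm _ _ hq).exists_quotient_lift 0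
  set Ψ := (univBall (0 : EuclideanSpace ℝ (Fin n)) δ).trans (univBall x ε) with hΨ
  have h0 : (0 : EuclideanSpace ℝ (Fin n)) ∈ Ψ.source := by simp [hΨ]
  have hΨ0 : Ψ 0 = x := by simp [hΨ]
  have hlc : Continuous l := by
    rw [Complex.UnitDisc.isEmbedding_coe.continuous_iff]
    exact ContDiff.continuous (𝕜 := ℝ) (n := ∞) hl
  refine ⟨Ψ.target, Ψ.open_target.mem_nhds (hΨ0 ▸ Ψ.map_source h0), l ∘ Ψ.symm,
    hlc.comp_continuousOn Ψ.continuousOn_symm, fun y hy => ?_⟩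
  have h1 := hlq (Ψ.symm y)
  have h2 : c.φ (Quotient.mk _ (l (Ψ.symm y))) = q (univBall 0 δ (Ψ.symm y)) := by
    rw [h1]; simp
  have h3 : Ψ (Ψ.symm y) = y := Ψ.right_inv hy
  calc c.lift (l (Ψ.symm y)) = q (univBall 0 δ (Ψ.symm y)) := congrArg Subtype.val h2
    _ = p (Ψ (Ψ.symm y)) := hqp _
    _ = p y := by rw [h3]

/-- For two charts with a common center there is a continuous transition map of the discs,
defined near the origin. -/
theorem exists_transition [IsDTopologyCompatible B] (c c' : OrbifoldChart B)
    (h : c.center = c'.center) :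
    ∃ F : 𝔻 → 𝔻, F 0 = 0 ∧ ∀ᶠ z in 𝓝 0, ContinuousAt F z ∧ c'.lift (F z) = c.lift z := by
  -- a plot of the disc that identifies the plane with it
  set Ψ := (univBall (0 : EuclideanSpace ℝ (Fin 2)) 1).trans
    Complex.orthonormalBasisOneI.repr.symm.toHomeomorph.toOpenPartialHomeomorph with hΨ
  have hnorm : ∀ y, ‖Ψ y‖ < 1 := fun y => by
    change ‖Complex.orthonormalBasisOneI.repr.symm (univBall _ 1 y)‖ < 1
    rw [LinearIsometryEquiv.norm_map]
    simpa using univBall_mem_ball 0 y one_pos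
  have hΨ0 : Ψ 0 = 0 := by simp [hΨ]
  have h0s : (0 : EuclideanSpace ℝ (Fin 2)) ∈ Ψ.source := by simp [hΨ]
  have h0t : (0 : ℂ) ∈ Ψ.target := hΨ0 ▸ Ψ.map_source h0s
  have hp : IsPlot fun y => Complex.UnitDisc.mk (Ψ y) (hnorm y) := by
    change ContDiff ℝ ∞ (Complex.orthonormalBasisOneI.repr.symm ∘
      univBall (0 : EuclideanSpace ℝ (Fin 2)) 1)
    exact Complex.orthonormalBasisOneI.repr.symm.contDiff.comp
      OpenPartialHomeomorph.contDiff_univBall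
  have hp0 : Complex.UnitDisc.mk (Ψ 0) (hnorm 0) = 0 := by simp [hΨ0]
  obtain ⟨u, hu, l, hl, hlu⟩ := c'.exists_lift_isPlot (c.isPlot_lift hp) (x := 0) (by
    change c.lift (Complex.UnitDisc.mk (Ψ 0) (hnorm 0)) ∈ _
    rw [hp0]
    have h' : c.lift 0 = c'.lift 0 := h
    rw [h']
    exact (c'.φ _).2)
  have hF : ∀ᶠ z : 𝔻 in 𝓝 0, (z : ℂ) ∈ Ψ.target ∧ Ψ.symm z ∈ interior u := by
    have h1 : ∀ᶠ z : ℂ in 𝓝 0, z ∈ Ψ.target ∧ Ψ.symm z ∈ interior u := by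
      refine (Ψ.open_target.eventually_mem h0t).and ?_
      refine (Ψ.continuousAt_symm h0t).eventually_mem ?_
      rw [← hΨ0, Ψ.left_inv h0s]
      exact isOpen_interior.mem_nhds (mem_interior_iff_mem_nhds.2 hu)
    exact Complex.UnitDisc.continuous_coe.continuousAt.eventually
      (p := fun z => z ∈ Ψ.target ∧ Ψ.symm z ∈ interior u) (by simpa using h1)
  have hlift : ∀ z : 𝔻, (z : ℂ) ∈ Ψ.target ∧ Ψ.symm z ∈ interior u →
      c'.lift (l (Ψ.symm z)) = c.lift z := fun z hz => by
    rw [hlu _ (interior_subset hz.2)]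
    refine congrArg c.lift (Complex.UnitDisc.coe_injective ?_)
    exact Ψ.right_inv hz.1
  refine ⟨fun z => l (Ψ.symm z), ?_, ?_⟩
  · have h1 : c'.lift (l (Ψ.symm (0 : 𝔻))) = c'.lift 0 := (hlift 0 hF.self_of_nhds).trans h
    obtain ⟨g, hg⟩ := c'.lift_eq_lift_iff.1 h1
    refine hg.symm.trans ?_
    exact Complex.UnitDisc.coe_injective (by simp [Subgroup.smul_def])
  · filter_upwards [hF] with z hz
    refine ⟨?_, hlift z hz⟩
    have h1 : ContinuousAt l (Ψ.symm z) :=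
      hl.continuousAt (mem_interior_iff_mem_nhds.1 hz.2)
    exact ContinuousAt.comp (f := fun z : 𝔻 => Ψ.symm z) h1
      ((Ψ.continuousAt_symm hz.1).comp Complex.UnitDisc.continuous_coe.continuousAt)

/-- If `F` and `G` are transition maps in the two directions, then `G ∘ F` is a rotation on a small
circle. So `F` is injective on an orbit of `c.Γ`, which it maps into an orbit of `c'.Γ`. -/
theorem card_le_of_center_eq [IsDTopologyCompatible B] (c c' : OrbifoldChart B)
    (h : c.center = c'.center) : Nat.card c.Γ ≤ Nat.card c'.Γ := by
  obtain ⟨F, hF0, hF⟩ := c.exists_transition c' h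
  obtain ⟨G, -, hG⟩ := c'.exists_transition c h.symm
  have hFG : ∀ᶠ z in 𝓝 0, (ContinuousAt F z ∧ c'.lift (F z) = c.lift z) ∧
      (ContinuousAt G (F z) ∧ c.lift (G (F z)) = c'.lift (F z)) := by
    have h0 : Tendsto F (𝓝 0) (𝓝 0) := by
      have := hF.self_of_nhds.1.tendsto
      rwa [hF0] at this
    exact hF.and (h0.eventually hG)
  obtain ⟨r, hr, hball⟩ : ∃ r > 0, ∀ z : 𝔻, ‖(z : ℂ)‖ < r →
      (ContinuousAt F z ∧ c'.lift (F z) = c.lift z) ∧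
      (ContinuousAt G (F z) ∧ c.lift (G (F z)) = c'.lift (F z)) := by
    rw [Complex.UnitDisc.isEmbedding_coe.nhds_eq_comap,
      (Metric.nhds_basis_ball.comap _).eventually_iff] at hFG
    simpa using hFG
  -- a point on a small circle around the origin
  obtain ⟨w, hw0, hwr⟩ : ∃ w : 𝔻, (w : ℂ) ≠ 0 ∧ ‖(w : ℂ)‖ < r := by
    have hpos : 0 < min r 1 / 2 := by positivity
    have hlt : min r 1 / 2 < min r 1 := half_lt_self (by positivity)
    have hnorm : ‖((min r 1 / 2 : ℝ) : ℂ)‖ = min r 1 / 2 := by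
      rw [Complex.norm_real, Real.norm_of_nonneg hpos.le]
    refine ⟨.mk ((min r 1 / 2 : ℝ) : ℂ) ?_, ?_, ?_⟩
    · rw [hnorm]; exact hlt.trans_le (min_le_right _ _)
    · rw [Complex.UnitDisc.coe_mk]; exact_mod_cast hpos.ne'
    · rw [Complex.UnitDisc.coe_mk, hnorm]; exact hlt.trans_le (min_le_left _ _)
  have hcircle : ∀ t : Circle, ‖((t • w : 𝔻) : ℂ)‖ < r := fun t => by
    simpa [Circle.norm_coe] using hwr
  -- `G ∘ F` moves each point by an element of the finite group, which is constant by continuity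
  have := c.finite_Γ
  have := c'.finite_Γ
  have hconst : ∃ γ : ℂ, γ ≠ 0 ∧ ∀ t : Circle, ((G (F (t • w)) : 𝔻) : ℂ) = γ * (t • w : 𝔻) := by
    have hmaps : Set.MapsTo (fun t : Circle => ((G (F (t • w)) : 𝔻) : ℂ) / (t • w : 𝔻)) Set.univ
        (Set.range fun g : c.Γ => ((g : Circle) : ℂ)) := fun t _ => by
      obtain ⟨-, h2⟩ := hball _ (hcircle t)
      obtain ⟨g, hg⟩ := c.lift_eq_lift_iff.1 (h2.2.trans (hball _ (hcircle t)).1.2)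
      refine ⟨g, ?_⟩
      simp [← hg, Subgroup.smul_def, hw0]
    have hcont : Continuous fun t : Circle => ((G (F (t • w)) : 𝔻) : ℂ) / (t • w : 𝔻) := by
      have ht : Continuous fun t : Circle => (t • w : 𝔻) := by
        rw [Complex.UnitDisc.isEmbedding_coe.continuous_iff]
        change Continuous fun t : Circle => (t : ℂ) * (w : ℂ)
        fun_prop
      refine (Complex.UnitDisc.continuous_coe.comp ?_).div
        (Complex.UnitDisc.continuous_coe.comp ht) (by simp [hw0])
      refine continuous_iff_continuousAt.2 fun t => ?_
      obtain ⟨h1, h2⟩ := hball _ (hcircle t)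
      exact ContinuousAt.comp (f := fun t : Circle => F (t • w)) h2.1
        (ContinuousAt.comp (f := fun t : Circle => t • w) h1.1 ht.continuousAt)
    have hdisc : IsDiscrete (Set.range fun g : c.Γ => ((g : Circle) : ℂ)) :=
      (Set.finite_range _).isDiscrete
    obtain ⟨_, ⟨g, rfl⟩, hγ⟩ := isPreconnected_univ.eqOn_const_of_mapsTo hdisc
      hcont.continuousOn hmaps (Set.range_nonempty _)
    refine ⟨_, Circle.coe_ne_zero g, fun t => ?_⟩
    have := hγ (Set.mem_univ t)
    rw [← div_eq_iff (by simp [hw0])]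
    exact this
  obtain ⟨γ, hγ0, hγ⟩ := hconst
  -- so `F` is injective on the orbit of `w`, which it maps to a single orbit
  have horbit : ∀ g : c.Γ, ∃ g' : c'.Γ, g' • F w = F (g • w) := fun g => by
    have h1 := (hball _ (hcircle g)).1.2
    have h2 := (hball _ hwr).1.2
    exact c'.lift_eq_lift_iff.1 (h1.trans ((c.lift_eq_lift_iff.2 ⟨g, rfl⟩).trans h2.symm))
  choose θ hθ using horbit
  refine Nat.card_le_card_of_injective θ fun g g' hgg' => ?_
  have h1 : F ((g : Circle) • w) = F ((g' : Circle) • w) :=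
    (hθ g).symm.trans ((congrArg (· • F w) hgg').trans (hθ g'))
  have h2 := (hγ g).symm.trans ((congrArg (fun z => ((G z : 𝔻) : ℂ)) h1).trans (hγ g'))
  exact Subtype.ext (Circle.ext (by simpa [hγ0, hw0] using h2))

/-- The order of a point does not depend on the chart. -/
theorem card_eq_of_center_eq [IsDTopologyCompatible B] (c c' : OrbifoldChart B)
    (h : c.center = c'.center) : Nat.card c.Γ = Nat.card c'.Γ :=
  (c.card_le_of_center_eq c' h).antisymm (c'.card_le_of_center_eq c h.symm)

end OrbifoldChart

/-! ### The degree map of a local model -/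

namespace CircleCocycle

variable {Γ : Subgroup Circle} [Fintype Γ] (α : CircleCocycle Γ)

/-- The product of `a(g, x)` over `g ∈ Γ` trivializes the `|Γ|`-th power of the cocycle. -/
theorem prod_a_smul_mul_pow (h : Γ) (x : 𝔻) :
    (∏ g, α.a g (h • x)) * α.a h x ^ Nat.card Γ = ∏ g, α.a g x := by
  rw [← Equiv.prod_comp (Equiv.mulRight h) fun g => α.a g x]
  simp [α.a_mul, Finset.prod_mul_distrib]

/-- The map `(𝔻 × 𝕊¹) / Γ → 𝕊¹`, `[x, s] ↦ (∏ g, a(g, x)) s ^ |Γ|`, which is equivariant with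
respect to the `|Γ|`-th power map of the circle. -/
def degreeMap : Quotient α.orbitRel → Circle :=
  Quotient.lift (fun p => (∏ g, α.a g p.1) * p.2 ^ Nat.card Γ) (by
    rintro p _ ⟨h, rfl⟩
    simp only [mul_pow, ← mul_assoc, α.prod_a_smul_mul_pow])

@[simp]
theorem degreeMap_mk (x : 𝔻) (s : Circle) :
    α.degreeMap (Quotient.mk _ (x, s)) = (∏ g, α.a g x) * s ^ Nat.card Γ := rfl

theorem continuous_degreeMap_comp_isPlot {n : ℕ}
    {p : EuclideanSpace ℝ (Fin n) → Quotient α.orbitRel} (hp : IsPlot p) :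
    Continuous (α.degreeMap ∘ p) := by
  refine continuous_quotient_comp_isPlot (fun {n l} hl => ?_) hp
  have h : IsPlot (Prod.fst ∘ l) ∧ IsPlot (Prod.snd ∘ l) := DiffeologicalSpace.isPlot_inf_iff.1 hl
  exact (continuous_finsetProd _ fun g _ =>
    (h.1.dSmooth_comp (α.smooth g)).continuous_circle).mul (h.2.continuous_circle.pow _)

end CircleCocycle

namespace CircleOrbibundleChart

variable {B M : Type*} [TopologicalSpace B] [DiffeologicalSpace B] [DiffeologicalSpace M]
  [MulAction Circle M] {ζ : M → B}

/-- Over the domain of a chart with group `Γ` there is a continuous map from the total space to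
the circle which has degree `|Γ|` along every orbit. -/
theorem exists_degreeMap [IsDTopologyCompatible B] [TopologicalSpace M] [IsDTopologyCompatible M]
    (hζ : DSmooth ζ) (c : CircleOrbibundleChart ζ) :
    ∃ P : C((ζ ⁻¹' c.domain : Set M), Circle), ∀ (t : Circle) (y z : (ζ ⁻¹' c.domain : Set M)),
      (z : M) = t • (y : M) → P z = t ^ Nat.card c.Γ * P y := by
  have := c.finite_Γ
  have := Fintype.ofFinite c.Γ
  refine ⟨⟨c.cocycle.degreeMap ∘ c.Φ.symm,
    continuous_of_continuous_comp_isPlot (c.isOpen_domain.preimage hζ.continuous') fun {n q} hq =>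
      c.cocycle.continuous_degreeMap_comp_isPlot (c.smooth_Φ_symm _ _ hq)⟩, fun t y z h => ?_⟩
  obtain ⟨p, rfl⟩ := c.Φ.surjective y
  induction p using Quotient.inductionOn with | h p =>
  obtain ⟨x, s⟩ := p
  obtain rfl : z = c.Φ (Quotient.mk _ (x, s * t)) :=
    Subtype.ext (h.trans (c.equivariant x s t).symm)
  simp only [ContinuousMap.coe_mk, Function.comp_apply, Equiv.symm_apply_apply,
    CircleCocycle.degreeMap_mk, mul_pow]
  ac_rfl

end CircleOrbibundleChart

/-! ### The local contributions to the Euler number -/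

namespace EulerData

variable {B M : Type*} [TopologicalSpace B] [DiffeologicalSpace B]
  [TopologicalSpace M] [DiffeologicalSpace M] [MulAction Circle M]
  {o : OrbifoldOrientation B} {ζ : M → B}

/-- The degree map over `D i` has degree `|Γ|` along the fiber, so `|Γ| * q i` is its degree along
the section over the boundary of `D i`. -/
theorem exists_int_q_eq_div [IsDTopologyCompatible B] [IsDTopologyCompatible M]
    (hζ : DSmooth ζ) (d : EulerData o ζ) (i : Fin (d.N + 1)) :
    ∃ k : ℤ, d.q i = k / Nat.card (d.chart i).Γ := by
  obtain ⟨P, hP⟩ := (d.chart i).exists_degreeMap hζ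
  have hsub : (ζ ⁻¹' (d.chart i).closedDisc (d.radius i)) ⊆ ζ ⁻¹' (d.chart i).domain :=
    Set.preimage_mono (OrbifoldChart.closedDisc_subset_domain _ _)
  obtain ⟨k, hk⟩ := exists_int_of_loopClass_eq_smul
    (P.comp ⟨Set.inclusion hsub, continuous_inclusion hsub⟩)
    (fun z => hP z (Set.inclusion hsub _) (Set.inclusion hsub _) (d.fiberLoop_smul i z))
    (d.loopClass_eq i)
  have := (d.chart i).finite_Γ
  exact ⟨k, (eq_div_iff (by exact_mod_cast Nat.card_pos.ne')).2 hk⟩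

end EulerData

end

theorem mainTheorem6 {B M : Type*}
    [TopologicalSpace B] [DiffeologicalSpace B] [IsTwoOrbifold B] [CompactSpace B]
    [ConnectedSpace B] (o : OrbifoldOrientation B)
    [TopologicalSpace M] [DiffeologicalSpace M] [IsDTopologyCompatible M] [MulAction Circle M]
    (ζ : M → B) (hζ : IsCircleOrbibundle ζ)
    (n : ℕ) (x : Fin n → B) (hx : Function.Injective x)
    (hsing : Set.range x = {p : B | IsSingularPoint p})
    (m : Fin n → ℕ) (hm : ∀ k, HasOrder (x k) (m k))
    (e : ℚ) (he : IsEulerNumber o ζ e) :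
    ∃ (b : ℤ) (c : Fin n → ℤ), e = b + ∑ k, (c k : ℚ) / (m k : ℚ) := by
  obtain ⟨d, rfl⟩ := he
  have := IsTwoOrbifold.dTopology_compatible (B := B)
  choose k hk using d.exists_int_q_eq_div hζ.smooth
  -- the group of a chart centered at the regular point `pt 0` is trivial
  have hcard0 : Nat.card (d.chart 0).Γ = 1 := by
    by_contra h
    refine d.regular_zero ⟨(d.chart 0).toOrbifoldChart, d.center_chart 0, fun hbot => h ?_⟩
    rw [hbot]
    simp
  -- both families enumerate the singular points
  have hinj : Function.Injective fun j : Fin d.N => d.pt j.succ :=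
    d.pt_injective.comp (Fin.succ_injective _)
  let σ : Fin n ≃ Fin d.N := (Equiv.ofInjective x hx).trans
    ((Equiv.setCongr (hsing.trans d.range_succ.symm)).trans (Equiv.ofInjective _ hinj).symm)
  have hσ : ∀ j, d.pt (σ j).succ = x j := fun j =>
    congrArg Subtype.val ((Equiv.ofInjective _ hinj).apply_symm_apply
      (Equiv.setCongr (hsing.trans d.range_succ.symm) (Equiv.ofInjective x hx j)))
  have hcard : ∀ j, Nat.card (d.chart (σ j).succ).Γ = m j := fun j => by
    obtain ⟨c, hc, hcm⟩ := hm j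
    rw [← hcm]
    exact OrbifoldChart.card_eq_of_center_eq _ _ ((d.center_chart _).trans ((hσ j).trans hc.symm))
  refine ⟨k 0, fun j => k (σ j).succ, ?_⟩
  rw [Fin.sum_univ_succ, hk 0, hcard0, Nat.cast_one, div_one, ← σ.sum_comp]
  congr 1
  exact Finset.sum_congr rfl fun j _ => by rw [hk, hcard]
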